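/- For positive parameters and $x>0$ put $$\Phi(x)={}_2F_3\left[\begin{array}{c}a_1,a_2\\ b_1,b_2,b_3\end{array}\Big|\,-x^2\right]=\sum_{n=0}^\infty\frac{(a_1)_n(a_2)_n}{n!\,(b_1)_n(b_2)_n(b_3)_n}(-x^2)^n,$$ where $(\alpha)_0=1$ and $(\alpha)_n=\alpha(\alpha+1)\cdots(\alpha+n-1)$ for $n\ge 1$. Let $\xi_1\le\xi_2\le\xi_3$ be the ascending arrangement of $a_2,\ a_1+\tfrac12,\ 2a_1$, and $\eta_1\le\eta_2\le\eta_3$ that of $a_1,\ a_2+\tfrac12,\ 2a_2$. Put $$A_1=(\xi_1,\xi_2,\xi_3),\ A_2=(\xi_2,\xi_1,\xi_3),\ A_3=(\xi_1,\xi_3,\xi_2),\ A_4=(\xi_3,\xi_1,\xi_2),\ A_5=(\xi_2,\xi_3,\xi_1),\ A_6=(\xi_3,\xi_2,\xi_1),$$ and let $B_1,\dots,B_6$ be the points obtained in the same way from $(\eta_1,\eta_2,\eta_3)$. Let $\mathbf S[A_iA_jB_jB_i]$ be the union over $\lambda\in[0,1]$ of the closed line segments joining $(1-\lambda)A_i+\lambda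 B_i$ and $(1-\lambda)A_j+\lambda B_j$. Let $a_1,a_2>0$ satisfy $a_1<a_2\le\min(2a_1,\tfrac12)$ if $a_1<\tfrac12$, and $a_1<a_2\le 2a_1$ if $a_1\ge\tfrac12$. Let $\mathbf S$ be any one of the three quadrilaterals $$\mathbf S[A_5A_6B_6B_5],\quad \mathbf S[A_1A_3B_3B_1],\quad \mathbf S[A_2A_4B_4B_2].$$ If $(b_1,b_2,b_3)\in\mathbf S$, then $\Phi(x)\ge0$ for all $x>0$; and if moreover $(b_1,b_2,b_3)$ is not one of the four vertices $A_i,A_j,B_j,B_i$ of $\mathbf S=\mathbf S[A_iA_jB_jB_i]$, then $\Phi(x)>0$ for all $x>0$. -/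

import Mathlib

noncomputable section

namespace SideQuad

/-- Pochhammer's symbol `(α)_n = α (α + 1) ⋯ (α + n - 1)`. -/
def poch (α : ℝ) (n : ℕ) : ℝ := (ascPochhammer ℝ n).eval α

/-- The generalized hypergeometric function `ₚF_q[u; v | z]` with lists `u`, `v` of real numerator
and denominator parameters, at a real argument. -/
def pFq (u v : List ℝ) (z : ℝ) : ℝ :=
  ∑' n : ℕ, (u.map fun α => poch α n).prod /
    ((n.factorial : ℝ) * (v.map fun β => poch β n).prod) * z ^ n

/-- `Φ(x) = ₂F₃[a₁, a₂; b₁, b₂, b₃ | -x²]`, with `b = (b₁, b₂, b₃)`. -/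
def Phi (a₁ a₂ : ℝ) (b : Fin 3 → ℝ) (x : ℝ) : ℝ :=
  pFq [a₁, a₂] [b 0, b 1, b 2] (-x ^ 2)

/-- The ascending arrangement of three real numbers. -/
def ascending (p q r : ℝ) : Fin 3 → ℝ :=
  ![min p (min q r), p + q + r - min p (min q r) - max p (max q r), max p (max q r)]

theorem ascending_perm (p q r : ℝ) :
    [ascending p q r 0, ascending p q r 1, ascending p q r 2].Perm [p, q, r] := by
  rw [← Multiset.coe_eq_coe]
  simp only [← Multiset.cons_coe, Multiset.coe_nil, ← Multiset.singleton_add, add_zero,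
    ascending, Matrix.cons_val]
  rcases le_total p q with h | h <;> rcases le_total q r with h' | h' <;>
    rcases le_total p r with h'' | h'' <;>
    simp only [min_eq_left, min_eq_right, max_eq_left, max_eq_right, h, h', h''] <;>
    ring_nf <;>
    first
    | done
    | abel1
    | (obtain rfl : p = q := by linarith
       obtain rfl : p = r := by linarith
       ring_nf)

theorem ascending_mono (p q r : ℝ) : Monotone (ascending p q r) := by
  rw [Fin.monotone_iff_le_succ]
  intro i
  fin_cases i <;> simp [ascending] <;>
    rcases le_total p q with h | h <;> rcases le_total q r with h' | h' <;>
    rcases le_total p r with h'' | h'' <;> simp [*] <;> grind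

/-- The labels of the six permutations of a triple. -/
inductive Label
  | one | two | three | four | five | six

/-- The labelled permutations of the triple `(t 0, t 1, t 2)`. -/
def permuted (t : Fin 3 → ℝ) : Label → Fin 3 → ℝ
  | .one => ![t 0, t 1, t 2]
  | .two => ![t 1, t 0, t 2]
  | .three => ![t 0, t 2, t 1]
  | .four => ![t 2, t 0, t 1]
  | .five => ![t 1, t 2, t 0]
  | .six => ![t 2, t 1, t 0]

/-- The triple `(ξ₁, ξ₂, ξ₃)`. -/
def xi (a₁ a₂ : ℝ) : Fin 3 → ℝ := ascending a₂ (a₁ + 1 / 2) (2 * a₁)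

/-- The triple `(η₁, η₂, η₃)`. -/
def eta (a₁ a₂ : ℝ) : Fin 3 → ℝ := ascending a₁ (a₂ + 1 / 2) (2 * a₂)

/-- The points `A₁, …, A₆`. -/
def A (a₁ a₂ : ℝ) (i : Label) : Fin 3 → ℝ := permuted (xi a₁ a₂) i

/-- The points `B₁, …, B₆`. -/
def B (a₁ a₂ : ℝ) (i : Label) : Fin 3 → ℝ := permuted (eta a₁ a₂) i

/-- The side quadrilateral `S[AᵢAⱼBⱼBᵢ]`: the union over `0 ≤ lam ≤ 1` of the segments joining
`(1 - lam) Aᵢ + lam Bᵢ` and `(1 - lam) Aⱼ + lam Bⱼ`. -/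
def S (a₁ a₂ : ℝ) (i j : Label) : Set (Fin 3 → ℝ) :=
  ⋃ lam ∈ Set.Icc (0 : ℝ) 1,
    segment ℝ ((1 - lam) • A a₁ a₂ i + lam • B a₁ a₂ i)
      ((1 - lam) • A a₁ a₂ j + lam • B a₁ a₂ j)

/-- The set `Σ` of admissible pairs `(a₁, a₂)`. -/
def admissible : Set (ℝ × ℝ) :=
  {a | 0 < a.1 ∧ 0 < a.2 ∧
    (a.1 < 1 / 2 → a.1 < a.2 ∧ a.2 ≤ min (2 * a.1) (1 / 2)) ∧
    (1 / 2 ≤ a.1 → a.1 < a.2 ∧ a.2 ≤ 2 * a.1)}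

end SideQuad

end

namespace SideQuad

open Finset

/-! ### The square of the Bessel series -/

/-! A point of the quadrilateral is described by two parameters: `lam` interpolates between the
ordered triples `xi` and `eta`, and `θ` mixes the second and third interpolated coordinates while
the first stays fixed. Put `c = (1 - lam) * a₁ + lam * a₂`.

The series `₁F₂[c; c + 1/2, 2c | -x²]` is the square of a Bessel series (`tsum_squareCoeff`), hence
nonnegative. `Phi` arises from it by multiplying the `k`-th coefficient by the ratio of rising
factorials with upper parameters `a₁, a₂, c + 1/2, 2c` and lower parameters `c, b 0, b 1, b 2`
(`Phi_eq_tsum`). Both lists have the same sum, so by Frullani's integral the ratio is a constant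
times `exp (moment G k)`, where `G` has the sign of `expDiff` (`prod_poch_div_poch`).

If `G ≥ 0`, multiplying coefficients by `moment G k` averages the function over the contractions `x
↦ x e^{-s}`. This preserves nonnegativity, and so does the exponential, as a power series with
positive coefficients in such multipliers (`tsum_mul_exp_moment_nonneg`).

It remains to show `expDiff ≥ 0`. Convexity of the exponential handles the mixing by `θ`, and
`exp_between_le` handles the interpolation by `lam`. Off the vertices one of the two is strict,
which makes `G` positive and then `Phi` positive. -/

theorem poch_zero (α : ℝ) : poch α 0 = 1 := by simp [poch]

theorem poch_succ (α : ℝ) (n : ℕ) : poch α (n + 1) = poch α n * (α + n) :=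
  ascPochhammer_succ_eval n α

theorem poch_pos {α : ℝ} (hα : 0 < α) (n : ℕ) : 0 < poch α n := ascPochhammer_pos n α hα

theorem poch_add (α : ℝ) (n m : ℕ) : poch α (n + m) = poch α n * poch (α + n) m := by
  induction m with
  | zero => simp [poch_zero]
  | succ m ih => rw [← add_assoc, poch_succ, ih, poch_succ]; push_cast; ring

/-- The Chu–Vandermonde identity for rising factorials. -/
theorem poch_vandermonde (r s : ℝ) (n : ℕ) :
    poch (r + s - n + 1) n =
      ∑ p ∈ antidiagonal n, (n.choose p.1 : ℝ) * (poch (r - p.1 + 1) p.1 * poch (s - p.2 + 1) p.2) := by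
  have h := Ring.descPochhammer_smeval_add (R := ℝ) n (Commute.all r s)
  simpa only [poch, Polynomial.descPochhammer_smeval_eq_ascPochhammer, Polynomial.ascPochhammer_smeval_eq_eval]
    using h

/-- The duplication formula for rising factorials. -/
theorem poch_two_mul (c : ℝ) (n : ℕ) :
    poch (2 * c) (2 * n) = 4 ^ n * poch c n * poch (c + 1 / 2) n := by
  induction n with
  | zero => simp [poch_zero]
  | succ n ih =>
    rw [show 2 * (n + 1) = 2 * n + 1 + 1 by ring, poch_succ, poch_succ, ih, poch_succ, poch_succ]
    push_cast
    ring

/-- The coefficients of the normalized Bessel series `₀F₁[; β | z / 4]`. -/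
noncomputable def besselCoeff (β : ℝ) (n : ℕ) : ℝ := (4 ^ n * n.factorial * poch β n)⁻¹

/-- The coefficients of `₁F₂[c; c + 1/2, 2c | z]`. -/
noncomputable def squareCoeff (c : ℝ) (n : ℕ) : ℝ :=
  poch c n / (n.factorial * (poch (c + 1 / 2) n * poch (2 * c) n))

theorem besselCoeff_pos {β : ℝ} (hβ : 0 < β) (n : ℕ) : 0 < besselCoeff β n := by
  have := poch_pos hβ n
  unfold besselCoeff
  positivity

theorem squareCoeff_pos {c : ℝ} (hc : 0 < c) (n : ℕ) : 0 < squareCoeff c n := by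
  have := poch_pos hc n
  have := poch_pos (show 0 < c + 1 / 2 by positivity) n
  have := poch_pos (show 0 < 2 * c by positivity) n
  unfold squareCoeff
  positivity

/-- Chu–Vandermonde evaluates the Cauchy square of the Bessel coefficients, and the duplication
formula brings the result to `₁F₂` form. -/
theorem sum_besselCoeff_mul {c : ℝ} (hc : 0 < c) (n : ℕ) :
    ∑ p ∈ antidiagonal n, besselCoeff (c + 1 / 2) p.1 * besselCoeff (c + 1 / 2) p.2 =
      squareCoeff c n := by
  set β := c + 1 / 2 with hβ
  have hβ0 : 0 < β := by positivity
  have hP := (poch_pos hβ0 n).ne'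
  -- Splitting `poch β n` at `p.1` and at `p.2` gives the summand of Vandermonde's identity with `r
  -- = s = β + n - 1`.
  have hterm : ∀ p ∈ antidiagonal n, besselCoeff β p.1 * besselCoeff β p.2 =
      (4 ^ n * n.factorial * poch β n ^ 2)⁻¹ * ((n.choose p.1 : ℝ) *
        (poch (β + n - 1 - p.1 + 1) p.1 * poch (β + n - 1 - p.2 + 1) p.2)) := by
    rintro ⟨i, j⟩ hp
    obtain rfl : i + j = n := by simpa using hp
    have hi := (poch_pos hβ0 i).ne'
    have hj := (poch_pos hβ0 j).ne'
    have hij : poch β (i + j) = poch β i * poch (β + i) j := poch_add _ _ _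
    have hji : poch β (i + j) = poch β j * poch (β + j) i := by rw [add_comm, poch_add]
    have hfac : ((i + j).choose i : ℝ) * i.factorial * j.factorial = (i + j).factorial := by
      rw [Nat.choose_symm_add]
      exact_mod_cast Nat.add_choose_mul_factorial_mul_factorial i j
    have e1 : β + ((i + j : ℕ) : ℝ) - 1 - i + 1 = β + j := by push_cast; ring
    have e2 : β + ((i + j : ℕ) : ℝ) - 1 - j + 1 = β + i := by push_cast; ring
    simp only [e1, e2, besselCoeff]
    rw [← hfac, sq]
    nth_rewrite 1 [hij]
    rw [hji]
    have hi' := (poch_pos (show 0 < β + i by positivity) j).ne'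
    have hj' := (poch_pos (show 0 < β + j by positivity) i).ne'
    have hch : ((i + j).choose i : ℝ) ≠ 0 := by
      exact_mod_cast (Nat.choose_pos (Nat.le_add_right i j)).ne'
    field_simp
    rw [pow_add]
  rw [sum_congr rfl hterm, ← mul_sum, ← poch_vandermonde]
  have e3 : β + n - 1 + (β + n - 1) - n + 1 = 2 * c + n := by rw [hβ]; ring
  have h2 : poch (2 * c) n * poch (2 * c + n) n = 4 ^ n * poch c n * poch β n := by
    rw [← poch_add, ← two_mul, poch_two_mul]
  have h2c := (poch_pos (show 0 < 2 * c by positivity) n).ne'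
  rw [e3, squareCoeff, ← hβ]
  field_simp
  linear_combination h2

theorem summable_besselCoeff {β : ℝ} (hβ : 1 / 2 ≤ β) (z : ℝ) :
    Summable fun n => ‖besselCoeff β n * z ^ n‖ := by
  -- Each new factor `4 * (β + n)` is at least `2`, so the exponential series dominates.
  have hone : ∀ n : ℕ, 1 ≤ 4 ^ n * poch β n := by
    intro n
    induction n with
    | zero => simp [poch_zero]
    | succ n ih =>
      have : (4 : ℝ) ^ (n + 1) * poch β (n + 1) = 4 ^ n * poch β n * (4 * (β + n)) := by
        rw [poch_succ]; ring
      rw [this]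
      exact one_le_mul_of_one_le_of_one_le ih (by linarith [n.cast_nonneg (α := ℝ)])
  refine (Real.summable_pow_div_factorial |z|).of_nonneg_of_le (fun _ => norm_nonneg _) fun n => ?_
  rw [norm_mul, norm_pow, Real.norm_eq_abs, Real.norm_eq_abs,
    abs_of_pos (besselCoeff_pos (by linarith) n), div_eq_inv_mul]
  gcongr
  unfold besselCoeff
  gcongr
  nlinarith [hone n, n.cast_nonneg (α := ℝ), n.factorial.cast_nonneg (α := ℝ)]

theorem summable_squareCoeff {c : ℝ} (hc : 0 < c) (z : ℝ) :
    Summable fun n => ‖squareCoeff c n * z ^ n‖ := by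
  have h := summable_besselCoeff (show 1 / 2 ≤ c + 1 / 2 by linarith) z
  refine (summable_norm_sum_mul_antidiagonal_of_summable_norm h h).congr fun n => ?_
  rw [← sum_besselCoeff_mul hc, sum_mul]
  congr 1
  refine sum_congr rfl fun p hp => ?_
  rw [← mem_antidiagonal.1 hp, pow_add]
  ring

theorem tsum_squareCoeff {c : ℝ} (hc : 0 < c) (z : ℝ) :
    ∑' n, squareCoeff c n * z ^ n = (∑' n, besselCoeff (c + 1 / 2) n * z ^ n) ^ 2 := by
  have h := summable_besselCoeff (show 1 / 2 ≤ c + 1 / 2 by linarith) z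
  rw [sq, tsum_mul_tsum_eq_tsum_sum_antidiagonal_of_summable_norm h h]
  refine tsum_congr fun n => ?_
  rw [← sum_besselCoeff_mul hc, sum_mul]
  refine sum_congr rfl fun p hp => ?_
  rw [← mem_antidiagonal.1 hp, pow_add]
  ring

theorem tsum_squareCoeff_nonneg {c : ℝ} (hc : 0 < c) (z : ℝ) :
    0 ≤ ∑' n, squareCoeff c n * z ^ n := by
  rw [tsum_squareCoeff hc]
  exact sq_nonneg _

end SideQuad

namespace SideQuad

open MeasureTheory Set Filter Topology

/-! ### Multiplying coefficients by the exponential of a moment sequence -/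

/-- The moments `∫₀^∞ e^{-ks} G(s) ds`. -/
noncomputable def moment (G : ℝ → ℝ) (k : ℕ) : ℝ := ∫ s in Ioi (0 : ℝ), Real.exp (-(k * s)) * G s

theorem integrableOn_exp_mul {G : ℝ → ℝ} (hG : IntegrableOn G (Ioi 0)) (k : ℕ) :
    IntegrableOn (fun s => Real.exp (-(k * s)) * G s) (Ioi 0) := by
  refine Integrable.bdd_mul (c := 1) hG (by fun_prop) ?_
  filter_upwards [ae_restrict_mem measurableSet_Ioi] with s hs
  rw [Real.norm_eq_abs, Real.abs_exp, Real.exp_le_one_iff]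
  have : (0 : ℝ) ≤ k * s := mul_nonneg k.cast_nonneg (le_of_lt hs)
  linarith

theorem moment_nonneg {G : ℝ → ℝ} (h0 : ∀ s, 0 < s → 0 ≤ G s) (k : ℕ) : 0 ≤ moment G k :=
  setIntegral_nonneg measurableSet_Ioi fun s hs => mul_nonneg (Real.exp_pos _).le (h0 s hs)

theorem moment_le {G : ℝ → ℝ} (hG : IntegrableOn G (Ioi 0)) (h0 : ∀ s, 0 < s → 0 ≤ G s) (k : ℕ) :
    moment G k ≤ moment G 0 := by
  refine setIntegral_mono_on (integrableOn_exp_mul hG k) (integrableOn_exp_mul hG 0)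
    measurableSet_Ioi fun s hs => mul_le_mul_of_nonneg_right ?_ (h0 s hs)
  have : (0 : ℝ) ≤ k * s := mul_nonneg k.cast_nonneg (le_of_lt hs)
  exact Real.exp_le_exp.2 (by simpa using this)

theorem summable_mul_moment {G : ℝ → ℝ} (hG : IntegrableOn G (Ioi 0))
    (h0 : ∀ s, 0 < s → 0 ≤ G s) {f : ℕ → ℝ} {x : ℝ} (hf : Summable fun k => ‖f k * x ^ k‖) :
    Summable fun k => ‖f k * moment G k * x ^ k‖ := by
  refine (hf.mul_left (moment G 0)).of_nonneg_of_le (fun _ => norm_nonneg _) fun k => ?_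
  rw [mul_right_comm, norm_mul, mul_comm, Real.norm_eq_abs (moment G k),
    abs_of_nonneg (moment_nonneg h0 k)]
  gcongr
  exact moment_le hG h0 k

/-- The factor `e^{-ks}` in the moment is absorbed into the `k`-th power of the argument, so the new
series is an average of the old one over contracted arguments. -/
theorem tsum_mul_moment {G : ℝ → ℝ} (hG : IntegrableOn G (Ioi 0))
    (h0 : ∀ s, 0 < s → 0 ≤ G s) {f : ℕ → ℝ} {x : ℝ} (hf : Summable fun k => ‖f k * x ^ k‖) :
    ∑' k, f k * moment G k * x ^ k =
      ∫ s in Ioi (0 : ℝ), (∑' k, f k * (x * Real.exp (-s)) ^ k) * G s := by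
  have hpow : ∀ (k : ℕ) (s : ℝ), f k * (x * Real.exp (-s)) ^ k * G s =
      f k * x ^ k * (Real.exp (-(k * s)) * G s) := by
    intro k s
    rw [mul_pow, ← Real.exp_nat_mul, mul_neg]
    ring
  have key := integral_tsum_of_summable_integral_norm (μ := volume.restrict (Ioi (0 : ℝ)))
    (F := fun k s => f k * x ^ k * (Real.exp (-(k * s)) * G s))
    (fun k => (integrableOn_exp_mul hG k).const_mul _) (by
      refine (summable_mul_moment hG h0 hf).congr fun k => ?_
      have : ∀ s ∈ Ioi (0 : ℝ), ‖f k * x ^ k * (Real.exp (-(k * s)) * G s)‖ =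
          ‖f k * x ^ k‖ * (Real.exp (-(k * s)) * G s) := by
        intro s hs
        rw [norm_mul, Real.norm_of_nonneg (mul_nonneg (Real.exp_pos _).le (h0 s hs))]
      rw [setIntegral_congr_fun measurableSet_Ioi this, integral_const_mul, mul_right_comm,
        norm_mul, Real.norm_of_nonneg (moment_nonneg h0 k), moment])
  simp only [← tsum_mul_right, hpow]
  rw [← key]
  refine tsum_congr fun k => ?_
  rw [integral_const_mul, moment]
  ring

theorem tsum_mul_moment_nonneg {G : ℝ → ℝ} (hG : IntegrableOn G (Ioi 0))
    (h0 : ∀ s, 0 < s → 0 ≤ G s) {f : ℕ → ℝ} (hf : ∀ x : ℝ, Summable fun k => ‖f k * x ^ k‖)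
    (hpos : ∀ x ≤ 0, 0 ≤ ∑' k, f k * x ^ k) {x : ℝ} (hx : x ≤ 0) :
    0 ≤ ∑' k, f k * moment G k * x ^ k := by
  rw [tsum_mul_moment hG h0 (hf x)]
  exact setIntegral_nonneg measurableSet_Ioi fun s hs => mul_nonneg
    (hpos _ (mul_nonpos_of_nonpos_of_nonneg hx (Real.exp_pos _).le)) (h0 s hs)

theorem norm_mul_exp_pow_le (f : ℕ → ℝ) (x : ℝ) (k : ℕ) {s : ℝ} (hs : 0 ≤ s) :
    ‖f k * (x * Real.exp (-s)) ^ k‖ ≤ ‖f k * x ^ k‖ := by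
  rw [mul_pow, ← mul_assoc, norm_mul]
  refine mul_le_of_le_one_right (norm_nonneg _) ?_
  rw [norm_pow, Real.norm_eq_abs, Real.abs_exp]
  exact pow_le_one₀ (Real.exp_pos _).le (Real.exp_le_one_iff.2 (by linarith))

/-- Zeros of the original series do no harm: as `s → ∞` the contracted argument tends to `0`, where
the series equals `f 0 > 0`, so the integrand is positive on a half-line. -/
theorem tsum_mul_moment_pos {G : ℝ → ℝ} (hG : IntegrableOn G (Ioi 0))
    (h0 : ∀ s, 0 < s → 0 < G s) {f : ℕ → ℝ} (hf : ∀ x : ℝ, Summable fun k => ‖f k * x ^ k‖)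
    (hpos : ∀ x ≤ 0, 0 ≤ ∑' k, f k * x ^ k) (hf0 : 0 < f 0) {x : ℝ} (hx : x ≤ 0) :
    0 < ∑' k, f k * moment G k * x ^ k := by
  have h0' : ∀ s, 0 < s → 0 ≤ G s := fun s hs => (h0 s hs).le
  rw [tsum_mul_moment hG h0' (hf x)]
  set F : ℝ → ℝ := fun s => ∑' k, f k * (x * Real.exp (-s)) ^ k with hF
  have hcont : ContinuousOn F (Ioi 0) :=
    continuousOn_tsum (fun k => by fun_prop) (hf x)
      fun k s hs => norm_mul_exp_pow_le f x k (le_of_lt hs)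
  have hint : IntegrableOn (fun s => F s * G s) (Ioi 0) := by
    refine Integrable.bdd_mul (c := ∑' k, ‖f k * x ^ k‖) hG
      (hcont.aestronglyMeasurable measurableSet_Ioi) ?_
    filter_upwards [ae_restrict_mem measurableSet_Ioi] with s hs
    exact tsum_of_norm_bounded (hf x).hasSum fun k => norm_mul_exp_pow_le f x k (le_of_lt hs)
  have hlim : Tendsto F atTop (𝓝 (f 0)) := by
    have h := tendsto_tsum_of_dominated_convergence (𝓕 := atTop)
      (f := fun s k => f k * (x * Real.exp (-s)) ^ k) (g := fun k => f k * (x * 0) ^ k) (hf x)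
      (fun k => ((Real.tendsto_exp_neg_atTop_nhds_zero.const_mul x).pow k).const_mul (f k))
      ((eventually_ge_atTop 0).mono fun s hs k => norm_mul_exp_pow_le f x k hs)
    rwa [tsum_eq_single 0 (by intro k hk; simp [hk]), pow_zero, mul_one] at h
  obtain ⟨S, hS⟩ := eventually_atTop.1 (hlim.eventually (lt_mem_nhds hf0))
  have hnn : ∀ s ∈ Ioi (0 : ℝ), 0 ≤ F s * G s := fun s hs => mul_nonneg
    (hpos _ (mul_nonpos_of_nonpos_of_nonneg hx (Real.exp_pos _).le)) (h0' s hs)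
  rw [setIntegral_pos_iff_support_of_nonneg_ae
    ((ae_restrict_mem measurableSet_Ioi).mono hnn) hint]
  refine lt_of_lt_of_le ?_ (measure_mono (s := Ioi (max S 0)) ?_)
  · simp
  · intro s hs
    have hs' := max_lt_iff.1 (mem_Ioi.1 hs)
    exact ⟨(mul_pos (hS s hs'.1.le) (h0 s hs'.2)).ne', hs'.2⟩

theorem summable_mul_moment_pow {G : ℝ → ℝ} (hG : IntegrableOn G (Ioi 0))
    (h0 : ∀ s, 0 < s → 0 ≤ G s) {f : ℕ → ℝ} (hf : ∀ x : ℝ, Summable fun k => ‖f k * x ^ k‖)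
    (m : ℕ) (x : ℝ) : Summable fun k => ‖f k * moment G k ^ m * x ^ k‖ := by
  induction m with
  | zero => simpa using hf x
  | succ m ih => simpa only [pow_succ, mul_assoc] using summable_mul_moment hG h0 ih

theorem tsum_mul_moment_pow_nonneg {G : ℝ → ℝ} (hG : IntegrableOn G (Ioi 0))
    (h0 : ∀ s, 0 < s → 0 ≤ G s) {f : ℕ → ℝ} (hf : ∀ x : ℝ, Summable fun k => ‖f k * x ^ k‖)
    (hpos : ∀ x ≤ 0, 0 ≤ ∑' k, f k * x ^ k) (m : ℕ) :
    ∀ x ≤ 0, 0 ≤ ∑' k, f k * moment G k ^ m * x ^ k := by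
  induction m with
  | zero => simpa using hpos
  | succ m ih =>
    intro x hx
    simpa only [pow_succ, mul_assoc] using
      tsum_mul_moment_nonneg hG h0 (summable_mul_moment_pow hG h0 hf m) ih hx

theorem hasSum_mul_exp_moment {G : ℝ → ℝ} (hG : IntegrableOn G (Ioi 0))
    (h0 : ∀ s, 0 < s → 0 ≤ G s) {f : ℕ → ℝ} {x : ℝ} (hf : Summable fun k => ‖f k * x ^ k‖) :
    HasSum (fun m : ℕ => (m.factorial : ℝ)⁻¹ * ∑' k, f k * moment G k ^ m * x ^ k)
      (∑' k, f k * Real.exp (moment G k) * x ^ k) := by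
  -- Moments are bounded by `moment G 0`, so a product of two convergent series dominates and the
  -- order of summation may be exchanged.
  have hprod : Summable fun p : ℕ × ℕ =>
      f p.2 * x ^ p.2 * (moment G p.2 ^ p.1 / p.1.factorial) := by
    refine Summable.of_norm_bounded ((Real.summable_pow_div_factorial (moment G 0)).mul_of_nonneg hf
      (fun m => div_nonneg (pow_nonneg (moment_nonneg h0 0) m) m.factorial.cast_nonneg)
      fun k => norm_nonneg _) ?_
    rintro ⟨m, k⟩
    have hk := moment_nonneg h0 k
    rw [norm_mul, mul_comm, Real.norm_of_nonneg (by positivity)]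
    have := moment_le hG h0 k
    gcongr
  have h1 : ∑' k, f k * Real.exp (moment G k) * x ^ k =
      ∑' p : ℕ × ℕ, f p.2 * x ^ p.2 * (moment G p.2 ^ p.1 / p.1.factorial) := by
    rw [hprod.tsum_prod, ← Summable.tsum_comm
      (f := fun m k : ℕ => f k * x ^ k * (moment G k ^ m / m.factorial)) hprod]
    refine tsum_congr fun k => ?_
    rw [tsum_mul_left, Real.exp_eq_exp_ℝ, NormedSpace.exp_eq_tsum_div]
    ring
  rw [h1]
  convert hprod.hasSum.prod_fiberwise fun m => (hprod.prod_factor m).hasSum using 2 with m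
  rw [← tsum_mul_left]
  exact tsum_congr fun k => by ring

/-- Multiplying coefficients by the exponential of a moment sequence preserves nonnegativity. -/
theorem tsum_mul_exp_moment_nonneg {G : ℝ → ℝ} (hG : IntegrableOn G (Ioi 0))
    (h0 : ∀ s, 0 < s → 0 ≤ G s) {f : ℕ → ℝ} (hf : ∀ x : ℝ, Summable fun k => ‖f k * x ^ k‖)
    (hpos : ∀ x ≤ 0, 0 ≤ ∑' k, f k * x ^ k) {x : ℝ} (hx : x ≤ 0) :
    0 ≤ ∑' k, f k * Real.exp (moment G k) * x ^ k :=
  (hasSum_mul_exp_moment hG h0 (hf x)).nonneg fun m => mul_nonneg (by positivity)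
    (tsum_mul_moment_pow_nonneg hG h0 hf hpos m x hx)

theorem tsum_mul_exp_moment_pos {G : ℝ → ℝ} (hG : IntegrableOn G (Ioi 0))
    (h0 : ∀ s, 0 < s → 0 < G s) {f : ℕ → ℝ} (hf : ∀ x : ℝ, Summable fun k => ‖f k * x ^ k‖)
    (hpos : ∀ x ≤ 0, 0 ≤ ∑' k, f k * x ^ k) (hf0 : 0 < f 0) {x : ℝ} (hx : x ≤ 0) :
    0 < ∑' k, f k * Real.exp (moment G k) * x ^ k := by
  have h0' : ∀ s, 0 < s → 0 ≤ G s := fun s hs => (h0 s hs).le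
  have hsum := hasSum_mul_exp_moment hG h0' (hf x)
  have hone := tsum_mul_moment_pos hG h0 hf hpos hf0 hx
  -- All terms of the exponential expansion are nonnegative; the linear term `m = 1` is already
  -- strictly positive.
  refine lt_of_lt_of_le ?_ (le_hasSum hsum 1 fun m _ => mul_nonneg (by positivity)
    (tsum_mul_moment_pow_nonneg hG h0' hf hpos m x hx))
  simpa using hone

end SideQuad

namespace SideQuad

open MeasureTheory Set Filter Topology

/-! ### Ratios of rising factorials as exponentials of moments -/

variable {ι : Type*} [Fintype ι] {α β : ι → ℝ}

/-- The difference `∑ e^{-αᵢ s} - ∑ e^{-βᵢ s}` of exponential sums. -/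
noncomputable def expDiff (α β : ι → ℝ) (s : ℝ) : ℝ :=
  ∑ i, (Real.exp (-(α i * s)) - Real.exp (-(β i * s)))

/-- The density whose moments are the logarithms of `∏ Γ(αᵢ + k) / Γ(βᵢ + k)`. -/
noncomputable def gammaKernel (α β : ι → ℝ) (s : ℝ) : ℝ :=
  expDiff α β s / (s * (1 - Real.exp (-s)))

theorem one_sub_exp_neg_pos {s : ℝ} (hs : 0 < s) : 0 < 1 - Real.exp (-s) := by
  have : Real.exp (-s) < 1 := Real.exp_lt_one_iff.2 (by linarith)
  linarith

theorem gammaKernel_nonneg {s : ℝ} (hs : 0 < s) (h : 0 ≤ expDiff α β s) :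
    0 ≤ gammaKernel α β s :=
  div_nonneg h (mul_pos hs (one_sub_exp_neg_pos hs)).le

theorem gammaKernel_pos {s : ℝ} (hs : 0 < s) (h : 0 < expDiff α β s) :
    0 < gammaKernel α β s :=
  div_pos h (mul_pos hs (one_sub_exp_neg_pos hs))

theorem exp_neg_le_quadratic {u : ℝ} (hu : 0 ≤ u) : Real.exp (-u) ≤ 1 - u + u ^ 2 / 2 := by
  have h := Real.quadratic_le_exp_of_nonneg hu
  have hpos : 0 < 1 + u + u ^ 2 / 2 := by positivity
  rw [Real.exp_neg]
  calc (Real.exp u)⁻¹ ≤ (1 + u + u ^ 2 / 2)⁻¹ := by gcongr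
    _ ≤ 1 - u + u ^ 2 / 2 := by
      rw [inv_le_iff_one_le_mul₀ hpos]
      nlinarith [pow_nonneg hu 4]

theorem expDiff_le_sq (hα : ∀ i, 0 < α i) (hsum : ∑ i, α i = ∑ i, β i) {s : ℝ} (hs : 0 ≤ s) :
    expDiff α β s ≤ (∑ i, α i ^ 2) * s ^ 2 := by
  -- The linear terms are kept because they cancel after summation over `i`.
  have hterm : ∀ i, Real.exp (-(α i * s)) - Real.exp (-(β i * s)) ≤
      α i ^ 2 * s ^ 2 + (β i - α i) * s := by
    intro i
    have h1 := exp_neg_le_quadratic (mul_nonneg (hα i).le hs)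
    have h2 := Real.add_one_le_exp (-(β i * s))
    nlinarith [sq_nonneg (α i * s)]
  calc expDiff α β s ≤ ∑ i, (α i ^ 2 * s ^ 2 + (β i - α i) * s) :=
        Finset.sum_le_sum fun i _ => hterm i
    _ = (∑ i, α i ^ 2) * s ^ 2 := by
      rw [Finset.sum_add_distrib, ← Finset.sum_mul, ← Finset.sum_mul, Finset.sum_sub_distrib, hsum]
      ring

theorem expDiff_le_sum (s : ℝ) : expDiff α β s ≤ ∑ i, Real.exp (-(α i * s)) :=
  Finset.sum_le_sum fun i _ => by linarith [Real.exp_pos (-(β i * s))]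

theorem continuous_expDiff : Continuous (expDiff α β) := by
  unfold expDiff
  fun_prop

theorem integrableOn_exp_neg_mul {a : ℝ} (ha : 0 < a) :
    IntegrableOn (fun s => Real.exp (-(a * s))) (Ioi 0) := by
  simpa only [neg_mul] using exp_neg_integrableOn_Ioi 0 ha

/-- Equality of the parameter sums removes the first-order term of `expDiff` at `0`, which
compensates the double zero of `s * (1 - e^{-s})`. For `s ≥ 1` positivity of the `α i` gives
exponential decay. -/
theorem integrableOn_gammaKernel (hα : ∀ i, 0 < α i) (hsum : ∑ i, α i = ∑ i, β i)
    (h0 : ∀ s, 0 < s → 0 ≤ expDiff α β s) : IntegrableOn (gammaKernel α β) (Ioi 0) := by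
  set C := ∑ i, α i ^ 2 with hC
  have hC0 : 0 ≤ C := Finset.sum_nonneg fun i _ => sq_nonneg _
  have hdom : IntegrableOn (fun s => 2 * ∑ i, Real.exp (-(α i * s)) +
      C * Real.exp 2 * Real.exp (-(1 * s))) (Ioi 0) :=
    ((integrable_finsetSum _ fun i _ => integrableOn_exp_neg_mul (hα i)).const_mul 2).add
      ((integrableOn_exp_neg_mul one_pos).const_mul _)
  refine hdom.mono' ?_ ?_
  · refine Measurable.aestronglyMeasurable ?_
    exact continuous_expDiff.measurable.div (by fun_prop)
  filter_upwards [ae_restrict_mem measurableSet_Ioi] with s hs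
  have hs : 0 < s := hs
  have he := one_sub_exp_neg_pos hs
  have hsum0 : 0 ≤ ∑ i, Real.exp (-(α i * s)) := Finset.sum_nonneg fun i _ => (Real.exp_pos _).le
  rw [Real.norm_of_nonneg (gammaKernel_nonneg hs (h0 s hs)), gammaKernel,
    div_le_iff₀ (mul_pos hs he)]
  rcases le_total s 1 with h1 | h1
  · have hE := expDiff_le_sq hα hsum hs.le
    have h2 : s * Real.exp (-s) ≤ 1 - Real.exp (-s) := by
      have h3 := Real.add_one_le_exp s
      have h4 : Real.exp s * Real.exp (-s) = 1 := by rw [← Real.exp_add]; simp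
      nlinarith [Real.exp_pos (-s)]
    have h5 : 1 ≤ Real.exp 2 * Real.exp (-(1 * s)) * Real.exp (-s) := by
      rw [← Real.exp_add, ← Real.exp_add]
      exact Real.one_le_exp (by linarith)
    calc expDiff α β s ≤ C * s ^ 2 * 1 := by linarith
      _ ≤ C * s ^ 2 * (Real.exp 2 * Real.exp (-(1 * s)) * Real.exp (-s)) := by gcongr
      _ = C * Real.exp 2 * Real.exp (-(1 * s)) * (s * (s * Real.exp (-s))) := by ring
      _ ≤ C * Real.exp 2 * Real.exp (-(1 * s)) * (s * (1 - Real.exp (-s))) := by gcongr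
      _ ≤ _ := by gcongr; linarith
  · have h2 : 1 / 2 ≤ 1 - Real.exp (-s) := by
      have h3 : Real.exp (-s) ≤ Real.exp (-1) := by gcongr
      have h4 := Real.exp_neg_one_lt_half
      linarith
    calc expDiff α β s ≤ ∑ i, Real.exp (-(α i * s)) := expDiff_le_sum s
      _ = 2 * (∑ i, Real.exp (-(α i * s))) * (1 * (1 / 2)) := by ring
      _ ≤ 2 * (∑ i, Real.exp (-(α i * s))) * (s * (1 - Real.exp (-s))) := by gcongr
      _ ≤ _ := by gcongr; exact le_add_of_nonneg_right (by positivity)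

theorem integrableOn_inv_mul_exp_sub_exp {a b : ℝ} (ha : 0 < a) (hb : 0 < b) :
    IntegrableOn (fun s => s⁻¹ * (Real.exp (-(a * s)) - Real.exp (-(b * s)))) (Ioi 0) := by
  wlog hab : a ≤ b generalizing a b
  · refine (this hb ha (le_of_not_ge hab)).neg.congr_fun (fun s _ => ?_) measurableSet_Ioi
    simp only [Pi.neg_apply]
    ring
  refine ((integrableOn_exp_neg_mul ha).const_mul (b - a)).mono'
    (Measurable.aestronglyMeasurable (by fun_prop)) ?_
  filter_upwards [ae_restrict_mem measurableSet_Ioi] with s hs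
  have hs : 0 < s := hs
  have h1 : Real.exp (-(b * s)) ≤ Real.exp (-(a * s)) := by gcongr
  have h2 : Real.exp (-(b * s)) = Real.exp (-(a * s)) * Real.exp (-((b - a) * s)) := by
    rw [← Real.exp_add]; ring_nf
  have h3 := Real.add_one_le_exp (-((b - a) * s))
  rw [Real.norm_of_nonneg (mul_nonneg (by positivity) (by linarith)), inv_mul_le_iff₀ hs, h2]
  nlinarith [Real.exp_pos (-(a * s))]

theorem integral_inv_mul_exp_sub_exp {a b : ℝ} (ha : 0 < a) (hb : 0 < b) :
    ∫ s in Ioi (0 : ℝ), s⁻¹ * (Real.exp (-(a * s)) - Real.exp (-(b * s))) = Real.log (b / a) := by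
  have hcont : Continuous fun u : ℝ => Real.exp (-u) := by fun_prop
  have h := Frullani.integral_Ioi_eq (f := fun u : ℝ => Real.exp (-u)) (L := 1) (R := 0)
    (hcont.locallyIntegrable.locallyIntegrableOn _) ha hb
    (by simpa using (hcont.tendsto 0).mono_left nhdsWithin_le_nhds)
    Real.tendsto_exp_neg_atTop_nhds_zero (integrableOn_inv_mul_exp_sub_exp ha hb)
  simpa using h

/-- Taking the difference cancels the factor `1 - e^{-s}` of the denominator and leaves a sum of
Frullani integrals. -/
theorem moment_gammaKernel_sub (hα : ∀ i, 0 < α i) (hβ : ∀ i, 0 < β i)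
    (hsum : ∑ i, α i = ∑ i, β i) (h0 : ∀ s, 0 < s → 0 ≤ expDiff α β s) (k : ℕ) :
    moment (gammaKernel α β) k - moment (gammaKernel α β) (k + 1) =
      ∑ i, Real.log ((β i + k) / (α i + k)) := by
  have hG := integrableOn_gammaKernel hα hsum h0
  have hα' : ∀ i, 0 < α i + k := fun i => add_pos_of_pos_of_nonneg (hα i) k.cast_nonneg
  have hβ' : ∀ i, 0 < β i + k := fun i => add_pos_of_pos_of_nonneg (hβ i) k.cast_nonneg
  simp_rw [moment, ← fun i => integral_inv_mul_exp_sub_exp (hα' i) (hβ' i)]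
  rw [← integral_sub (integrableOn_exp_mul hG k) (integrableOn_exp_mul hG (k + 1)),
    ← integral_finsetSum _ fun i _ => integrableOn_inv_mul_exp_sub_exp (hα' i) (hβ' i)]
  refine setIntegral_congr_fun measurableSet_Ioi fun s hs => ?_
  have hs : 0 < s := hs
  have he := (one_sub_exp_neg_pos hs).ne'
  have hsplit : ∀ a : ℝ, Real.exp (-((a + k) * s)) = Real.exp (-(k * s)) * Real.exp (-(a * s)) := by
    intro a
    rw [← Real.exp_add]; ring_nf
  have hk : Real.exp (-(((k + 1 : ℕ) : ℝ) * s)) = Real.exp (-(k * s)) * Real.exp (-s) := by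
    rw [← Real.exp_add]; push_cast; ring_nf
  simp only [hsplit, hk, ← mul_sub, ← Finset.mul_sum]
  rw [← expDiff, gammaKernel]
  field_simp

/-- Telescoping of the moment differences; the initial moment only supplies the normalization at `k
= 0`. -/
theorem prod_poch_div_poch (hα : ∀ i, 0 < α i) (hβ : ∀ i, 0 < β i)
    (hsum : ∑ i, α i = ∑ i, β i) (h0 : ∀ s, 0 < s → 0 ≤ expDiff α β s) (k : ℕ) :
    ∏ i, poch (α i) k / poch (β i) k =
      Real.exp (-moment (gammaKernel α β) 0) * Real.exp (moment (gammaKernel α β) k) := by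
  induction k with
  | zero => simp [poch_zero, ← Real.exp_add]
  | succ k ih =>
    have hstep := moment_gammaKernel_sub hα hβ hsum h0 k
    have hα' : ∀ i, 0 < α i + k := fun i => add_pos_of_pos_of_nonneg (hα i) k.cast_nonneg
    have hβ' : ∀ i, 0 < β i + k := fun i => add_pos_of_pos_of_nonneg (hβ i) k.cast_nonneg
    have hratio : ∏ i, (α i + k) / (β i + k) =
        Real.exp (-∑ i, Real.log ((β i + k) / (α i + k))) := by
      rw [← Finset.sum_neg_distrib, Real.exp_sum]
      refine Finset.prod_congr rfl fun i _ => ?_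
      rw [Real.exp_neg, Real.exp_log (div_pos (hβ' i) (hα' i)), inv_div]
    simp only [poch_succ, mul_div_mul_comm]
    rw [Finset.prod_mul_distrib, ih, hratio, ← hstep, mul_assoc, ← Real.exp_add]
    ring_nf

/-- Multiplying coefficients by `∏ (αᵢ)ₖ / (βᵢ)ₖ` preserves nonnegativity on the negative axis when
`∑ e^{-αᵢ s} ≥ ∑ e^{-βᵢ s}`. -/
theorem tsum_mul_prod_poch_nonneg (hα : ∀ i, 0 < α i) (hβ : ∀ i, 0 < β i)
    (hsum : ∑ i, α i = ∑ i, β i) (h0 : ∀ s, 0 < s → 0 ≤ expDiff α β s) {f : ℕ → ℝ}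
    (hf : ∀ x : ℝ, Summable fun k => ‖f k * x ^ k‖)
    (hpos : ∀ x ≤ 0, 0 ≤ ∑' k, f k * x ^ k) {x : ℝ} (hx : x ≤ 0) :
    0 ≤ ∑' k, f k * (∏ i, poch (α i) k / poch (β i) k) * x ^ k := by
  have h := tsum_mul_exp_moment_nonneg (integrableOn_gammaKernel hα hsum h0)
    (fun s hs => gammaKernel_nonneg hs (h0 s hs)) hf hpos hx
  simp_rw [prod_poch_div_poch hα hβ hsum h0, mul_left_comm (f _), mul_assoc (Real.exp _)]
  rw [tsum_mul_left]
  exact mul_nonneg (Real.exp_pos _).le h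

theorem tsum_mul_prod_poch_pos (hα : ∀ i, 0 < α i) (hβ : ∀ i, 0 < β i)
    (hsum : ∑ i, α i = ∑ i, β i) (h0 : ∀ s, 0 < s → 0 < expDiff α β s) {f : ℕ → ℝ}
    (hf : ∀ x : ℝ, Summable fun k => ‖f k * x ^ k‖)
    (hpos : ∀ x ≤ 0, 0 ≤ ∑' k, f k * x ^ k) (hf0 : 0 < f 0) {x : ℝ} (hx : x ≤ 0) :
    0 < ∑' k, f k * (∏ i, poch (α i) k / poch (β i) k) * x ^ k := by
  have h0' : ∀ s, 0 < s → 0 ≤ expDiff α β s := fun s hs => (h0 s hs).le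
  have h := tsum_mul_exp_moment_pos (integrableOn_gammaKernel hα hsum h0')
    (fun s hs => gammaKernel_pos hs (h0 s hs)) hf hpos hf0 hx
  simp_rw [prod_poch_div_poch hα hβ hsum h0', mul_left_comm (f _), mul_assoc (Real.exp _)]
  rw [tsum_mul_left]
  exact mul_pos (Real.exp_pos _) h

end SideQuad

namespace SideQuad

/-! ### Inequalities between exponential sums on the side quadrilaterals -/

theorem exp_neg_combo_le (p q s : ℝ) {θ : ℝ} (h0 : 0 ≤ θ) (h1 : θ ≤ 1) :
    Real.exp (-(((1 - θ) * p + θ * q) * s)) ≤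
      (1 - θ) * Real.exp (-(p * s)) + θ * Real.exp (-(q * s)) := by
  have h := convexOn_exp.2 (Set.mem_univ (-(p * s))) (Set.mem_univ (-(q * s)))
    (sub_nonneg.2 h1) h0 (sub_add_cancel 1 θ)
  have e : -(((1 - θ) * p + θ * q) * s) = (1 - θ) * -(p * s) + θ * -(q * s) := by ring
  rwa [e]

theorem exp_neg_combo_lt {p q s : ℝ} (hpq : p ≠ q) (hs : 0 < s) {θ : ℝ} (h0 : 0 < θ)
    (h1 : θ < 1) :
    Real.exp (-(((1 - θ) * p + θ * q) * s)) <
      (1 - θ) * Real.exp (-(p * s)) + θ * Real.exp (-(q * s)) := by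
  have hne : -(p * s) ≠ -(q * s) := by
    rw [Ne, neg_inj]
    exact fun h => hpq (mul_right_cancel₀ hs.ne' h)
  have h := strictConvexOn_exp.2 (Set.mem_univ (-(p * s))) (Set.mem_univ (-(q * s))) hne
    (sub_pos.2 h1) h0 (sub_add_cancel 1 θ)
  have e : -(((1 - θ) * p + θ * q) * s) = (1 - θ) * -(p * s) + θ * -(q * s) := by ring
  rwa [e]

theorem exp_neg_pair_le (p q s : ℝ) {θ : ℝ} (h0 : 0 ≤ θ) (h1 : θ ≤ 1) :
    Real.exp (-(((1 - θ) * p + θ * q) * s)) + Real.exp (-((θ * p + (1 - θ) * q) * s)) ≤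
      Real.exp (-(p * s)) + Real.exp (-(q * s)) := by
  have e : θ * p + (1 - θ) * q = (1 - θ) * q + θ * p := by ring
  rw [e]
  linarith [exp_neg_combo_le p q s h0 h1, exp_neg_combo_le q p s h0 h1]

theorem exp_neg_pair_lt {p q s : ℝ} (hpq : p ≠ q) (hs : 0 < s) {θ : ℝ} (h0 : 0 < θ)
    (h1 : θ < 1) :
    Real.exp (-(((1 - θ) * p + θ * q) * s)) + Real.exp (-((θ * p + (1 - θ) * q) * s)) <
      Real.exp (-(p * s)) + Real.exp (-(q * s)) := by
  have e : θ * p + (1 - θ) * q = (1 - θ) * q + θ * p := by ring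
  rw [e]
  linarith [exp_neg_combo_lt hpq hs h0 h1, exp_neg_combo_lt hpq.symm hs h0 h1]

theorem exp_neg_mul_le_bernoulli (s : ℝ) {θ : ℝ} (h0 : 0 ≤ θ) (h1 : θ ≤ 1) :
    Real.exp (-(θ / 2 * s)) ≤ 1 - θ + θ * Real.exp (-(1 / 2 * s)) := by
  have h := exp_neg_combo_le 0 (1 / 2) s h0 h1
  simp only [zero_mul, neg_zero, Real.exp_zero] at h
  convert h using 2 <;> ring

theorem exp_neg_mul_lt_bernoulli {s : ℝ} (hs : 0 < s) {θ : ℝ} (h0 : 0 < θ) (h1 : θ < 1) :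
    Real.exp (-(θ / 2 * s)) < 1 - θ + θ * Real.exp (-(1 / 2 * s)) := by
  have h := exp_neg_combo_lt (p := 0) (q := 1 / 2) (by norm_num) hs h0 h1
  simp only [zero_mul, neg_zero, Real.exp_zero] at h
  convert h using 2 <;> ring

theorem exp_neg_half_shift_eq (a₁ a₂ s lam : ℝ) :
    Real.exp (-((a₁ + (1 - lam) / 2) * s)) = Real.exp (-(a₁ * s)) * Real.exp (-((1 - lam) / 2 * s)) ∧
    Real.exp (-((a₂ + lam / 2) * s)) = Real.exp (-(a₂ * s)) * Real.exp (-(lam / 2 * s)) ∧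
    Real.exp (-(((1 - lam) * a₁ + lam * a₂ + 1 / 2) * s)) =
      Real.exp (-(((1 - lam) * a₁ + lam * a₂) * s)) * Real.exp (-(1 / 2 * s)) := by
  simp only [← Real.exp_add]
  refine ⟨?_, ?_, ?_⟩ <;> ring_nf

/-- An exponential-sum inequality that does not follow from majorization of the exponents. -/
theorem exp_neg_half_shift_le (a₁ a₂ : ℝ) {s lam : ℝ} (hs : 0 < s) (h0 : 0 ≤ lam) (h1 : lam ≤ 1) :
    Real.exp (-(((1 - lam) * a₁ + lam * a₂) * s)) + Real.exp (-((a₁ + (1 - lam) / 2) * s)) +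
        Real.exp (-((a₂ + lam / 2) * s)) ≤
      Real.exp (-(a₁ * s)) + Real.exp (-(a₂ * s)) +
        Real.exp (-(((1 - lam) * a₁ + lam * a₂ + 1 / 2) * s)) := by
  obtain ⟨e1, e2, e3⟩ := exp_neg_half_shift_eq a₁ a₂ s lam
  have hZ := exp_neg_combo_le a₁ a₂ s h0 h1
  have hu : Real.exp (-(1 / 2 * s)) < 1 := Real.exp_lt_one_iff.2 (by linarith)
  have hb1 := mul_le_mul_of_nonneg_left
    (exp_neg_mul_le_bernoulli s (sub_nonneg.2 h1) (sub_le_self 1 h0)) (Real.exp_pos (-(a₁ * s))).le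
  have hb2 := mul_le_mul_of_nonneg_left
    (exp_neg_mul_le_bernoulli s h0 h1) (Real.exp_pos (-(a₂ * s))).le
  -- With `u = e^{-s/2}`, the goal bounds `(1 - u) e^{-cs}`, where `c = (1 - lam) * a₁ + lam * a₂`.
  -- Convexity splits this into the parts `(1 - lam)(1 - u) e^{-a₁ s}` and `lam (1 - u) e^{-a₂ s}`,
  -- which `hb1` and `hb2` absorb.
  have hZ' := mul_le_mul_of_nonneg_right hZ (sub_pos.2 hu).le
  rw [e1, e2, e3]
  linarith

theorem exp_neg_half_shift_lt (a₁ a₂ : ℝ) {s lam : ℝ} (hs : 0 < s) (h0 : 0 < lam) (h1 : lam < 1) :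
    Real.exp (-(((1 - lam) * a₁ + lam * a₂) * s)) + Real.exp (-((a₁ + (1 - lam) / 2) * s)) +
        Real.exp (-((a₂ + lam / 2) * s)) <
      Real.exp (-(a₁ * s)) + Real.exp (-(a₂ * s)) +
        Real.exp (-(((1 - lam) * a₁ + lam * a₂ + 1 / 2) * s)) := by
  obtain ⟨e1, e2, e3⟩ := exp_neg_half_shift_eq a₁ a₂ s lam
  have hZ := exp_neg_combo_le a₁ a₂ s h0.le h1.le
  have hu : Real.exp (-(1 / 2 * s)) < 1 := Real.exp_lt_one_iff.2 (by linarith)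
  have hb1 := mul_lt_mul_of_pos_left
    (exp_neg_mul_lt_bernoulli hs (sub_pos.2 h1) (sub_lt_self 1 h0)) (Real.exp_pos (-(a₁ * s)))
  have hb2 := mul_lt_mul_of_pos_left
    (exp_neg_mul_lt_bernoulli hs h0 h1) (Real.exp_pos (-(a₂ * s)))
  have hZ' := mul_le_mul_of_nonneg_right hZ (sub_pos.2 hu).le
  rw [e1, e2, e3]
  linarith

/-! ### Orderings of the parameters and coordinates on the quadrilaterals -/

/-- Admissibility leaves only three joint orderings; they are separated by `a₁` against `1/2` and
then `a₂` against `a₁ + 1/2`. -/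
theorem xi_eta_cases {a₁ a₂ : ℝ} (ha : (a₁, a₂) ∈ admissible) :
    (xi a₁ a₂ = ![a₂, 2 * a₁, a₁ + 1 / 2] ∧ eta a₁ a₂ = ![a₁, 2 * a₂, a₂ + 1 / 2]) ∨
    (xi a₁ a₂ = ![a₂, a₁ + 1 / 2, 2 * a₁] ∧ eta a₁ a₂ = ![a₁, a₂ + 1 / 2, 2 * a₂]) ∨
    (xi a₁ a₂ = ![a₁ + 1 / 2, a₂, 2 * a₁] ∧ eta a₁ a₂ = ![a₁, a₂ + 1 / 2, 2 * a₂]) := by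
  obtain ⟨h1, h2, hlt, hge⟩ := ha
  simp only [xi, eta, ascending] at *
  rcases lt_or_ge a₁ (1 / 2) with h | h
  · obtain ⟨h3, h4⟩ := hlt h
    obtain ⟨h5, h6⟩ := le_min_iff.1 h4
    left
    rw [min_eq_right (show 2 * a₁ ≤ a₁ + 1 / 2 by linarith), min_eq_left h5,
      max_eq_left (show 2 * a₁ ≤ a₁ + 1 / 2 by linarith),
      max_eq_right (show a₂ ≤ a₁ + 1 / 2 by linarith),
      min_eq_right (show 2 * a₂ ≤ a₂ + 1 / 2 by linarith),
      min_eq_left (show a₁ ≤ 2 * a₂ by linarith),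
      max_eq_left (show 2 * a₂ ≤ a₂ + 1 / 2 by linarith),
      max_eq_right (show a₁ ≤ a₂ + 1 / 2 by linarith)]
    constructor <;> congr 2 <;> ring
  · obtain ⟨h3, h4⟩ := hge h
    right
    rw [min_eq_left (show a₁ + 1 / 2 ≤ 2 * a₁ by linarith),
      max_eq_right (show a₁ + 1 / 2 ≤ 2 * a₁ by linarith), max_eq_right h4,
      min_eq_left (show a₂ + 1 / 2 ≤ 2 * a₂ by linarith),
      max_eq_right (show a₂ + 1 / 2 ≤ 2 * a₂ by linarith),
      min_eq_left (show a₁ ≤ a₂ + 1 / 2 by linarith), max_eq_right (show a₁ ≤ 2 * a₂ by linarith)]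
    rcases le_total a₂ (a₁ + 1 / 2) with h5 | h5
    · left
      rw [min_eq_left h5]
      constructor <;> congr 2 <;> ring
    · right
      rw [min_eq_right h5]
      constructor <;> congr 2 <;> ring

/-- The point `(1 - lam) ξ + lam η`. -/
noncomputable def between (a₁ a₂ lam : ℝ) : Fin 3 → ℝ := (1 - lam) • xi a₁ a₂ + lam • eta a₁ a₂

theorem between_pos {a₁ a₂ : ℝ} (ha : (a₁, a₂) ∈ admissible) {lam : ℝ} (h0 : 0 ≤ lam)
    (h1 : lam ≤ 1) (k : Fin 3) : 0 < between a₁ a₂ lam k := by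
  have ha1 : 0 < a₁ := ha.1
  have ha2 : 0 < a₂ := ha.2.1
  have hpos : ∀ {p q : ℝ}, 0 < p → 0 < q → 0 < (1 - lam) * p + lam * q := by
    intro p q hp hq
    rcases h0.eq_or_lt with rfl | h
    · simpa using hp
    · have := mul_nonneg (sub_nonneg.2 h1) hp.le
      have := mul_pos h hq
      linarith
  rcases xi_eta_cases ha with ⟨hx, he⟩ | ⟨hx, he⟩ | ⟨hx, he⟩ <;>
    simp only [between, hx, he] <;> fin_cases k <;> simp <;> apply hpos <;> positivity

theorem sum_between {a₁ a₂ : ℝ} (ha : (a₁, a₂) ∈ admissible) (lam : ℝ) :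
    between a₁ a₂ lam 0 + between a₁ a₂ lam 1 + between a₁ a₂ lam 2 =
      a₁ + a₂ + 1 / 2 + 2 * ((1 - lam) * a₁ + lam * a₂) := by
  rcases xi_eta_cases ha with ⟨hx, he⟩ | ⟨hx, he⟩ | ⟨hx, he⟩ <;>
    simp [between, hx, he] <;> ring

theorem fst_lt_snd_of_admissible {a₁ a₂ : ℝ} (ha : (a₁, a₂) ∈ admissible) : a₁ < a₂ := by
  obtain ⟨-, -, hlt, hge⟩ := ha
  rcases lt_or_ge a₁ (1 / 2) with h | h
  · exact (hlt h).1
  · exact (hge h).1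

/-- Symmetric sums over the coordinates of `(1 - lam) ξ + lam η`, in terms of the parameters. -/
theorem sum_between_cases {a₁ a₂ : ℝ} (ha : (a₁, a₂) ∈ admissible) (lam : ℝ) (φ : ℝ → ℝ) :
    let c := (1 - lam) * a₁ + lam * a₂
    (φ (between a₁ a₂ lam 0) + φ (between a₁ a₂ lam 1) + φ (between a₁ a₂ lam 2) =
      φ (lam * a₁ + (1 - lam) * a₂) + φ (c + 1 / 2) + φ (2 * c)) ∨
    (φ (between a₁ a₂ lam 0) + φ (between a₁ a₂ lam 1) + φ (between a₁ a₂ lam 2) =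
      φ (a₁ + (1 - lam) / 2) + φ (a₂ + lam / 2) + φ (2 * c)) := by
  intro c
  have e1 : (1 - lam) * a₂ + lam * a₁ = lam * a₁ + (1 - lam) * a₂ := by ring
  have e2 : (1 - lam) * (2 * a₁) + lam * (2 * a₂) = 2 * c := by ring
  have e3 : (1 - lam) * (a₁ + 1 / 2) + lam * (a₂ + 1 / 2) = c + 1 / 2 := by ring
  have e4 : (1 - lam) * (a₁ + 1 / 2) + lam * a₁ = a₁ + (1 - lam) / 2 := by ring
  have e5 : (1 - lam) * a₂ + lam * (a₂ + 1 / 2) = a₂ + lam / 2 := by ring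
  rcases xi_eta_cases ha with ⟨hx, he⟩ | ⟨hx, he⟩ | ⟨hx, he⟩
  · left
    simp only [between, hx, he, Pi.add_apply, Pi.smul_apply, smul_eq_mul, Matrix.cons_val, e1, e2, e3]
    ring
  · left
    simp only [between, hx, he, Pi.add_apply, Pi.smul_apply, smul_eq_mul, Matrix.cons_val, e1, e2, e3]
  · right
    simp only [between, hx, he, Pi.add_apply, Pi.smul_apply, smul_eq_mul, Matrix.cons_val, e2, e4, e5]

/-- The term with exponent `2c` always cancels. In the first case so does `c + 1/2`, leaving two
exponents that are majorized by `a₁, a₂`; in the second case `exp_neg_half_shift_le` is needed. -/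
theorem exp_between_le {a₁ a₂ : ℝ} (ha : (a₁, a₂) ∈ admissible) {lam : ℝ} (h0 : 0 ≤ lam)
    (h1 : lam ≤ 1) {s : ℝ} (hs : 0 < s) :
    let c := (1 - lam) * a₁ + lam * a₂
    Real.exp (-(c * s)) + (Real.exp (-(between a₁ a₂ lam 0 * s)) +
        Real.exp (-(between a₁ a₂ lam 1 * s)) + Real.exp (-(between a₁ a₂ lam 2 * s))) ≤
      Real.exp (-(a₁ * s)) + Real.exp (-(a₂ * s)) + Real.exp (-((c + 1 / 2) * s)) +
        Real.exp (-((2 * c) * s)) := by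
  intro c
  rcases sum_between_cases ha lam fun p => Real.exp (-(p * s)) with h | h <;> rw [h]
  · linarith [exp_neg_pair_le a₁ a₂ s h0 h1]
  · linarith [exp_neg_half_shift_le a₁ a₂ hs h0 h1]

theorem exp_between_lt {a₁ a₂ : ℝ} (ha : (a₁, a₂) ∈ admissible) {lam : ℝ} (h0 : 0 < lam)
    (h1 : lam < 1) {s : ℝ} (hs : 0 < s) :
    let c := (1 - lam) * a₁ + lam * a₂
    Real.exp (-(c * s)) + (Real.exp (-(between a₁ a₂ lam 0 * s)) +
        Real.exp (-(between a₁ a₂ lam 1 * s)) + Real.exp (-(between a₁ a₂ lam 2 * s))) <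
      Real.exp (-(a₁ * s)) + Real.exp (-(a₂ * s)) + Real.exp (-((c + 1 / 2) * s)) +
        Real.exp (-((2 * c) * s)) := by
  intro c
  rcases sum_between_cases ha lam fun p => Real.exp (-(p * s)) with h | h <;> rw [h]
  · linarith [exp_neg_pair_lt (fst_lt_snd_of_admissible ha).ne hs h0 h1]
  · linarith [exp_neg_half_shift_lt a₁ a₂ hs h0 h1]

theorem permuted_between (a₁ a₂ lam : ℝ) (i : Label) :
    (1 - lam) • A a₁ a₂ i + lam • B a₁ a₂ i = permuted (between a₁ a₂ lam) i := by
  ext k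
  cases i <;> fin_cases k <;> simp [A, B, permuted, between]

/-- Coordinates of a point of a side quadrilateral. Off the vertices, the point is not on the two
extreme segments, or it is in the interior of one of them. -/
theorem exists_of_mem_S {a₁ a₂ : ℝ} {i j : Label}
    (hij : (i = .five ∧ j = .six) ∨ (i = .one ∧ j = .three) ∨ (i = .two ∧ j = .four))
    {b : Fin 3 → ℝ} (hb : b ∈ S a₁ a₂ i j) :
    ∃ lam θ : ℝ, 0 ≤ lam ∧ lam ≤ 1 ∧ 0 ≤ θ ∧ θ ≤ 1 ∧
      (∀ φ : ℝ → ℝ, φ (b 0) + φ (b 1) + φ (b 2) = φ (between a₁ a₂ lam 0) +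
        φ ((1 - θ) * between a₁ a₂ lam 1 + θ * between a₁ a₂ lam 2) +
        φ (θ * between a₁ a₂ lam 1 + (1 - θ) * between a₁ a₂ lam 2)) ∧
      (∀ k, b k = between a₁ a₂ lam 0 ∨
        b k = (1 - θ) * between a₁ a₂ lam 1 + θ * between a₁ a₂ lam 2 ∨
        b k = θ * between a₁ a₂ lam 1 + (1 - θ) * between a₁ a₂ lam 2) ∧
      (b ∉ ({A a₁ a₂ i, A a₁ a₂ j, B a₁ a₂ j, B a₁ a₂ i} : Set (Fin 3 → ℝ)) →
        (0 < lam ∧ lam < 1) ∨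
        (0 < θ ∧ θ < 1 ∧ between a₁ a₂ lam 1 ≠ between a₁ a₂ lam 2)) := by
  simp only [S, Set.mem_iUnion] at hb
  obtain ⟨lam, ⟨h0, h1⟩, w, θ, hw, hθ, hwθ, hb⟩ := hb
  obtain rfl : w = 1 - θ := by linarith
  refine ⟨lam, θ, h0, h1, hθ, by linarith, ?_, ?_, ?_⟩
  · intro φ
    rw [permuted_between, permuted_between] at hb
    subst hb
    rcases hij with ⟨rfl, rfl⟩ | ⟨rfl, rfl⟩ | ⟨rfl, rfl⟩ <;> simp [permuted]
    all_goals
      rw [show ∀ p : ℝ, (1 - θ) * p + θ * p = p by intro p; ring,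
        add_comm (θ * between a₁ a₂ lam 1)]
    all_goals ring
  · intro k
    rw [permuted_between, permuted_between] at hb
    subst hb
    rcases hij with ⟨rfl, rfl⟩ | ⟨rfl, rfl⟩ | ⟨rfl, rfl⟩ <;> fin_cases k <;> simp [permuted] <;>
      grind
  · intro hv
    simp only [Set.mem_insert_iff, Set.mem_singleton_iff, not_or] at hv
    obtain ⟨hAi, hAj, hBj, hBi⟩ := hv
    by_contra! hcon
    have hend : ∃ l : Label, b = permuted (between a₁ a₂ lam) l ∧ (l = i ∨ l = j) := by
      rw [permuted_between, permuted_between] at hb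
      rcases hθ.eq_or_lt with rfl | hθ0
      · exact ⟨i, by rw [← hb]; simp, Or.inl rfl⟩
      rcases (show θ ≤ 1 by linarith).eq_or_lt with rfl | hθ1
      · exact ⟨j, by rw [← hb]; simp, Or.inr rfl⟩
      -- Here the segment is degenerate: its two endpoints coincide, so an interior `θ` still gives
      -- an endpoint.
      · refine ⟨i, ?_, Or.inl rfl⟩
        have heq := hcon.2 hθ0 hθ1
        have hperm : permuted (between a₁ a₂ lam) j = permuted (between a₁ a₂ lam) i := by
          rcases hij with ⟨rfl, rfl⟩ | ⟨rfl, rfl⟩ | ⟨rfl, rfl⟩ <;> simp [permuted, heq]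
        rw [← hb, hperm, ← add_smul, sub_add_cancel, one_smul]
    obtain ⟨l, hl, hlij⟩ := hend
    rw [← permuted_between] at hl
    rcases h0.eq_or_lt with rfl | h0
    · rcases hlij with rfl | rfl
      · exact hAi (by simpa using hl)
      · exact hAj (by simpa using hl)
    · obtain rfl : lam = 1 := le_antisymm h1 (hcon.1 h0)
      rcases hlij with rfl | rfl
      · exact hBi (by simpa using hl)
      · exact hBj (by simpa using hl)

/-! ### Transference from the squared Bessel series to `Phi` -/

theorem Phi_eq_tsum (a₁ a₂ : ℝ) {b : Fin 3 → ℝ} (hb : ∀ k, 0 < b k) {c : ℝ} (hc : 0 < c) (x : ℝ) :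
    Phi a₁ a₂ b x = ∑' k, squareCoeff c k *
      (∏ i, poch (![a₁, a₂, c + 1 / 2, 2 * c] i) k / poch (![c, b 0, b 1, b 2] i) k) *
        (-x ^ 2) ^ k := by
  unfold Phi pFq
  refine tsum_congr fun k => ?_
  have h1 := (poch_pos hc k).ne'
  have h2 := (poch_pos (show 0 < c + 1 / 2 by positivity) k).ne'
  have h3 := (poch_pos (show 0 < 2 * c by positivity) k).ne'
  have h4 := (poch_pos (hb 0) k).ne'
  have h5 := (poch_pos (hb 1) k).ne'
  have h6 := (poch_pos (hb 2) k).ne'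
  congr 1
  simp only [squareCoeff, Fin.prod_univ_four, Matrix.cons_val, List.map_cons, List.map_nil,
    List.prod_cons, List.prod_nil]
  generalize poch (c + 1 / 2) k = u at *
  generalize poch (2 * c) k = v at *
  field_simp

end SideQuad

theorem proposition4 (a₁ a₂ : ℝ) (ha : (a₁, a₂) ∈ SideQuad.admissible)
    (i j : SideQuad.Label)
    (hij : (i = .five ∧ j = .six) ∨ (i = .one ∧ j = .three) ∨ (i = .two ∧ j = .four))
    (b : Fin 3 → ℝ) (hb : b ∈ SideQuad.S a₁ a₂ i j) :
    (∀ x : ℝ, 0 < x → 0 ≤ SideQuad.Phi a₁ a₂ b x) ∧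
      (b ∉ ({SideQuad.A a₁ a₂ i, SideQuad.A a₁ a₂ j, SideQuad.B a₁ a₂ j,
          SideQuad.B a₁ a₂ i} : Set (Fin 3 → ℝ)) →
        ∀ x : ℝ, 0 < x → 0 < SideQuad.Phi a₁ a₂ b x) := by
  open SideQuad in
  obtain ⟨lam, θ, hl0, hl1, hθ0, hθ1, hφ, hcoord, hvert⟩ := exists_of_mem_S hij hb
  have ha1 : 0 < a₁ := ha.1
  have ha2 : 0 < a₂ := ha.2.1
  have hcombo : ∀ {t p q : ℝ}, 0 ≤ t → t ≤ 1 → 0 < p → 0 < q → 0 < (1 - t) * p + t * q :=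
    fun ht0 ht1 hp hq => convex_Ioi (𝕜 := ℝ) (0 : ℝ) hp hq (sub_nonneg.2 ht1) ht0 (by ring)
  set c := (1 - lam) * a₁ + lam * a₂ with hcdef
  have hc : 0 < c := hcombo hl0 hl1 ha1 ha2
  have hP := between_pos ha hl0 hl1
  have hbpos : ∀ k, 0 < b k := by
    intro k
    rcases hcoord k with h | h | h <;> rw [h]
    · exact hP 0
    · exact hcombo hθ0 hθ1 (hP 1) (hP 2)
    · rw [add_comm]
      exact hcombo hθ0 hθ1 (hP 2) (hP 1)
  have hα : ∀ k, 0 < ![a₁, a₂, c + 1 / 2, 2 * c] k := by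
    intro k
    fin_cases k <;> simp <;> positivity
  have hβ : ∀ k, 0 < ![c, b 0, b 1, b 2] k := by
    intro k
    fin_cases k <;> simp [hc, hbpos]
  have hsum : ∑ k, ![a₁, a₂, c + 1 / 2, 2 * c] k = ∑ k, ![c, b 0, b 1, b 2] k := by
    have h := hφ id
    have h' := sum_between ha lam
    simp only [id] at h
    simp only [Fin.sum_univ_four, Matrix.cons_val]
    linarith
  have hdiff : ∀ s, expDiff ![a₁, a₂, c + 1 / 2, 2 * c] ![c, b 0, b 1, b 2] s =
      Real.exp (-(a₁ * s)) + Real.exp (-(a₂ * s)) + Real.exp (-((c + 1 / 2) * s)) +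
        Real.exp (-((2 * c) * s)) - (Real.exp (-(c * s)) +
        (Real.exp (-(between a₁ a₂ lam 0 * s)) +
        Real.exp (-(((1 - θ) * between a₁ a₂ lam 1 + θ * between a₁ a₂ lam 2) * s)) +
        Real.exp (-((θ * between a₁ a₂ lam 1 + (1 - θ) * between a₁ a₂ lam 2) * s)))) := by
    intro s
    have h := hφ fun p => Real.exp (-(p * s))
    rw [← h]
    simp only [expDiff, Fin.sum_univ_four, Matrix.cons_val]
    ring
  constructor
  · intro x _
    rw [Phi_eq_tsum a₁ a₂ hbpos hc]
    refine tsum_mul_prod_poch_nonneg hα hβ hsum (fun s hs => ?_) (summable_squareCoeff hc)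
      (fun z _ => tsum_squareCoeff_nonneg hc z) (neg_nonpos.2 (sq_nonneg x))
    -- Two convexity losses add up: one from interpolating by `lam`, one from mixing the last two
    -- coordinates by `θ`.
    rw [hdiff]
    linarith [exp_between_le ha hl0 hl1 hs,
      exp_neg_pair_le (between a₁ a₂ lam 1) (between a₁ a₂ lam 2) s hθ0 hθ1]
  · intro hv x _
    rw [Phi_eq_tsum a₁ a₂ hbpos hc]
    refine tsum_mul_prod_poch_pos hα hβ hsum (fun s hs => ?_) (summable_squareCoeff hc)
      (fun z _ => tsum_squareCoeff_nonneg hc z) (squareCoeff_pos hc 0) (neg_nonpos.2 (sq_nonneg x))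
    rw [hdiff]
    rcases hvert hv with ⟨h0, h1⟩ | ⟨h0, h1, hne⟩
    · linarith [exp_between_lt ha h0 h1 hs,
        exp_neg_pair_le (between a₁ a₂ lam 1) (between a₁ a₂ lam 2) s hθ0 hθ1]
    · linarith [exp_between_le ha hl0 hl1 hs, exp_neg_pair_lt hne hs h0 h1]
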